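/- Let $K$ be a field and let $A$ be an $n$-dimensional perfect evolution algebra over $K$ ($n\ge 1$): $A$ is a (not necessarily associative) $K$-algebra with a basis $e_1,\dots,e_n$ such that $e_ie_j=0$ for $i\neq j$, and $A$ is spanned by its products ($A^2=A$). For a commutative $K$-algebra $R$ put $A_R=R\otimes_K A$, and let $\mathbf{Taut}(A)(R)$ be the group, under componentwise composition, of triples $(f_1,f_2,f_3)$ of bijective $R$-linear maps $A_R\to A_R$ with $f_1(xy)=f_2(x)f_3(y)$ for all $x,y\in A_R$. Let $\underline{S_n}$ be the constant group scheme over $K$ attached to the symmetric group $S_n$, and write $\mathbf{G}_m^{2n}=\mathbf{G}_m^{n}\times\mathbf{G}_m^{n}$. Then $\mathbf{Taut}(A)$ is an affine algebraic group scheme over $K$ (it is represented by a finitely generated commutative $K$-algebra), and: 1. The identity component of $\mathbf{Taut}(A)$ is isomorphic, as a group scheme over $K$, to the torus $\mathbf{G}_m^{2n}$. 2. There is an isomorphism of group schemes over $K$ $$\mathbf{Taut}(A)\;\cong\;\mathbf{G}_m^{2n}\rtimes\underline{S_n},$$ where $\underline{S_n}$ acts by permuting the $n$ coordinates of both factors $\mathbf{G}_m^{n}$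 simultaneously, and under this isomorphism the normal factor $\mathbf{G}_m^{2n}$ corresponds to the identity component of $\mathbf{Taut}(A)$. 3. In particular, as schemes over $K$, $\mathbf{Taut}(A)\cong\mathbf{G}_m^{2n}\times\underline{S_n}$. -/

import Mathlib

open CategoryTheory TensorProduct

universe u

noncomputable section

namespace EvolutionAlgebra

/-! ### Evolution algebras and ternary automorphisms -/

section Algebras

/-- A (not necessarily associative or unital) algebra `A` is an `n`-dimensional evolution algebra if
it has a natural basis: a basis `e₁, …, eₙ` with `eᵢ * eⱼ = 0` for `i ≠ j`. -/
def IsEvolutionAlgebra (K A : Type*) [Field K] [NonUnitalNonAssocRing A] [Module K A] (n : ℕ) :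
    Prop :=
  ∃ e : Module.Basis (Fin n) K A, ∀ i j, i ≠ j → e i * e j = 0

/-- `A` is perfect if `A² = A`, where `A²` is the linear span of all products. -/
def IsPerfectAlgebra (K A : Type*) [Field K] [NonUnitalNonAssocRing A] [Module K A] : Prop :=
  Submodule.span K (Set.range fun p : A × A => p.1 * p.2) = ⊤

/-- The group of ternary automorphisms of an algebra `B` over a commutative ring `R`: triples of
bijective `R`-linear maps with `f₁ (x y) = f₂ x f₃ y`, under componentwise composition. -/
def ternaryAut (R B : Type*) [CommRing R] [NonUnitalNonAssocRing B] [Module R B] :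
    Subgroup ((B ≃ₗ[R] B) × (B ≃ₗ[R] B) × (B ≃ₗ[R] B)) where
  carrier := {f | ∀ x y : B, f.1 (x * y) = f.2.1 x * f.2.2 y}
  one_mem' := fun _ _ => rfl
  mul_mem' := by
    intro f g hf hg x y
    change f.1 (g.1 (x * y)) = f.2.1 (g.2.1 x) * f.2.2 (g.2.2 y)
    rw [hg x y, hf]
  inv_mem' := by
    intro f hf x y
    change f.1.symm (x * y) = f.2.1.symm x * f.2.2.symm y
    rw [LinearEquiv.symm_apply_eq, hf]
    simp

end Algebras

/-! ### Base change of ternary automorphisms -/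

section BaseChange

variable {K : Type*} [Field K] (A : Type*) [NonUnitalNonAssocRing A] [Module K A]
  {R S T : Type*} [CommRing R] [Algebra K R] [CommRing S] [Algebra K S] [CommRing T] [Algebra K T]

/-- The base change to `S` of an `R`-linear endomorphism `f` of `R ⊗ A` along `φ : R → S`: the unique
`S`-linear endomorphism of `S ⊗ A` that is compatible with `f` under `φ ⊗ id : R ⊗ A → S ⊗ A`. -/
def extendMap (φ : R →ₐ[K] S) (f : R ⊗[K] A →ₗ[R] R ⊗[K] A) : S ⊗[K] A →ₗ[S] S ⊗[K] A :=
  LinearMap.liftBaseChange S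
    (φ.toLinearMap.rTensor A ∘ₗ f.restrictScalars K ∘ₗ TensorProduct.mk K R A 1)

variable {A}

theorem rTensor_smul (φ : R →ₐ[K] S) (r : R) (x : R ⊗[K] A) :
    φ.toLinearMap.rTensor A (r • x) = φ r • φ.toLinearMap.rTensor A x := by
  induction x with
  | zero => simp
  | tmul a b => simp [TensorProduct.smul_tmul']
  | add x y hx hy => simp [smul_add, hx, hy]

theorem extendMap_rTensor (φ : R →ₐ[K] S) (f : R ⊗[K] A →ₗ[R] R ⊗[K] A) (x : R ⊗[K] A) :
    extendMap A φ f (φ.toLinearMap.rTensor A x) = φ.toLinearMap.rTensor A (f x) := by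
  induction x with
  | zero => simp
  | tmul r a =>
    have : (r ⊗ₜ[K] a : R ⊗[K] A) = r • ((1 : R) ⊗ₜ[K] a) := by simp [TensorProduct.smul_tmul']
    rw [this, rTensor_smul, map_smul, map_smul, rTensor_smul]
    simp [extendMap]
  | add x y hx hy => simp [hx, hy]

theorem extendMap_unique (φ : R →ₐ[K] S) {g h : S ⊗[K] A →ₗ[S] S ⊗[K] A}
    (H : ∀ x : R ⊗[K] A, g (φ.toLinearMap.rTensor A x) = h (φ.toLinearMap.rTensor A x)) :
    g = h := by
  ext a
  simpa using H (1 ⊗ₜ a)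

theorem extendMap_id (φ : R →ₐ[K] S) :
    extendMap A φ (LinearMap.id : R ⊗[K] A →ₗ[R] R ⊗[K] A) = LinearMap.id :=
  extendMap_unique φ fun x => by rw [extendMap_rTensor]; rfl

theorem extendMap_comp (φ : R →ₐ[K] S) (f g : R ⊗[K] A →ₗ[R] R ⊗[K] A) :
    extendMap A φ (f ∘ₗ g) = extendMap A φ f ∘ₗ extendMap A φ g :=
  extendMap_unique φ fun x => by
    simp only [LinearMap.comp_apply, extendMap_rTensor]

/-- Base change of an invertible endomorphism of `R ⊗ A`. -/
def extendEquiv (φ : R →ₐ[K] S) (f : (R ⊗[K] A) ≃ₗ[R] (R ⊗[K] A)) :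
    (S ⊗[K] A) ≃ₗ[S] (S ⊗[K] A) :=
  LinearEquiv.ofLinearMap (extendMap A φ f) (extendMap A φ f.symm)
    (by rw [← extendMap_comp]; simp [extendMap_id])
    (by rw [← extendMap_comp]; simp [extendMap_id])

theorem extendEquiv_rTensor (φ : R →ₐ[K] S) (f : (R ⊗[K] A) ≃ₗ[R] (R ⊗[K] A)) (x : R ⊗[K] A) :
    extendEquiv φ f (φ.toLinearMap.rTensor A x) = φ.toLinearMap.rTensor A (f x) :=
  extendMap_rTensor φ _ x

theorem extendEquiv_unique (φ : R →ₐ[K] S) {g h : (S ⊗[K] A) ≃ₗ[S] (S ⊗[K] A)}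
    (H : ∀ x : R ⊗[K] A, g (φ.toLinearMap.rTensor A x) = h (φ.toLinearMap.rTensor A x)) :
    g = h :=
  LinearEquiv.toLinearMap_injective (extendMap_unique φ H)

theorem extendEquiv_mul (φ : R →ₐ[K] S) (f g : (R ⊗[K] A) ≃ₗ[R] (R ⊗[K] A)) :
    extendEquiv φ (f * g) = extendEquiv φ f * extendEquiv φ g :=
  extendEquiv_unique φ fun x => by
    simp only [LinearEquiv.mul_apply, extendEquiv_rTensor]

variable [IsScalarTower K A A] [SMulCommClass K A A]

theorem rTensor_mul (φ : R →ₐ[K] S) (x y : R ⊗[K] A) :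
    φ.toLinearMap.rTensor A (x * y) =
      φ.toLinearMap.rTensor A x * φ.toLinearMap.rTensor A y := by
  induction x with
  | zero => simp
  | add x x' hx hx' => simp [add_mul, hx, hx']
  | tmul r a =>
    induction y with
    | zero => simp
    | add y y' hy hy' => simp [mul_add, hy, hy']
    | tmul s b => simp [Algebra.TensorProduct.tmul_mul_tmul]

theorem map_mul_of_rTensor (φ : R →ₐ[K] S) (F₁ F₂ F₃ : S ⊗[K] A →ₗ[S] S ⊗[K] A)
    (H : ∀ x y : R ⊗[K] A, F₁ (φ.toLinearMap.rTensor A x * φ.toLinearMap.rTensor A y) =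
      F₂ (φ.toLinearMap.rTensor A x) * F₃ (φ.toLinearMap.rTensor A y)) (x y : S ⊗[K] A) :
    F₁ (x * y) = F₂ x * F₃ y := by
  have key : ∀ (s : S) (a : A), (s ⊗ₜ[K] a : S ⊗[K] A) =
      s • φ.toLinearMap.rTensor A ((1 : R) ⊗ₜ[K] a) := fun s a => by
    simp [TensorProduct.smul_tmul']
  induction x with
  | zero => simp
  | add x x' hx hx' => simp only [add_mul, map_add, hx, hx']
  | tmul s a =>
    induction y with
    | zero => simp
    | add y y' hy hy' => simp only [mul_add, map_add, hy, hy']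
    | tmul t b =>
      rw [key s a, key t b, smul_mul_assoc, mul_smul_comm, map_smul, map_smul, H, map_smul,
        map_smul, smul_mul_assoc, mul_smul_comm]

/-- The group homomorphism `Taut(A_R) → Taut(A_S)` induced by `φ : R → S`. -/
def ternaryAutMap (φ : R →ₐ[K] S) : ternaryAut R (R ⊗[K] A) →* ternaryAut S (S ⊗[K] A) where
  toFun f := ⟨(extendEquiv φ f.1.1, extendEquiv φ f.1.2.1, extendEquiv φ f.1.2.2), by
    refine map_mul_of_rTensor φ (extendEquiv φ f.1.1).toLinearMap
      (extendEquiv φ f.1.2.1).toLinearMap (extendEquiv φ f.1.2.2).toLinearMap fun x y => ?_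
    simp only [LinearEquiv.coe_coe, ← rTensor_mul, extendEquiv_rTensor]
    rw [f.2 x y]⟩
  map_one' := by
    refine Subtype.ext (Prod.ext ?_ (Prod.ext ?_ ?_)) <;>
    exact extendEquiv_unique φ fun x => by rw [extendEquiv_rTensor]; rfl
  map_mul' f g := by
    refine Subtype.ext (Prod.ext ?_ (Prod.ext ?_ ?_)) <;> exact extendEquiv_mul φ _ _

theorem ternaryAutMap_id (f : ternaryAut R (R ⊗[K] A)) : ternaryAutMap (AlgHom.id K R) f = f := by
  have key : ∀ g : (R ⊗[K] A) ≃ₗ[R] (R ⊗[K] A), extendEquiv (AlgHom.id K R) g = g := fun g =>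
    extendEquiv_unique (AlgHom.id K R) fun x => by
      rw [extendEquiv_rTensor]; simp
  exact Subtype.ext (Prod.ext (key _) (Prod.ext (key _) (key _)))

theorem ternaryAutMap_comp (ψ : S →ₐ[K] T) (φ : R →ₐ[K] S) (f : ternaryAut R (R ⊗[K] A)) :
    ternaryAutMap (ψ.comp φ) f = ternaryAutMap ψ (ternaryAutMap φ f) := by
  have key : ∀ x : R ⊗[K] A, (ψ.comp φ).toLinearMap.rTensor A x =
      ψ.toLinearMap.rTensor A (φ.toLinearMap.rTensor A x) := fun x => by
    rw [AlgHom.comp_toLinearMap, LinearMap.rTensor_comp_apply]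
  have key' : ∀ g : (R ⊗[K] A) ≃ₗ[R] (R ⊗[K] A),
      extendEquiv (ψ.comp φ) g = extendEquiv ψ (extendEquiv φ g) := fun g =>
    extendEquiv_unique (ψ.comp φ) fun x => by
      rw [extendEquiv_rTensor, key, key, extendEquiv_rTensor, extendEquiv_rTensor]
  exact Subtype.ext (Prod.ext (key' _) (Prod.ext (key' _) (key' _)))

end BaseChange

/-! ### Group functors -/

/-- The group functor `R ↦ Taut(A_R)` of ternary automorphisms, `A_R = R ⊗ A`. -/
def tautFunctor (K A : Type u) [Field K] [NonUnitalNonAssocRing A] [Module K A]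
    [IsScalarTower K A A] [SMulCommClass K A A] : CommAlgCat.{u} K ⥤ GrpCat.{u} where
  obj R := GrpCat.of (ternaryAut R (R ⊗[K] A))
  map φ := GrpCat.ofHom (ternaryAutMap φ.hom)
  map_id R := by ext f : 2; exact ternaryAutMap_id f
  map_comp φ ψ := by ext f : 2; exact ternaryAutMap_comp ψ.hom φ.hom f

/-- The homomorphism on tori `(Rˣ)^ι → (Sˣ)^ι` induced by a ring homomorphism. -/
def gmMap (ι : Type*) {R S : Type*} [CommRing R] [CommRing S] (φ : R →+* S) :
    (ι → Rˣ) →* (ι → Sˣ) where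
  toFun t i := Units.map φ (t i)
  map_one' := by ext; simp
  map_mul' s t := by ext; simp

/-- The torus `G_m^ι`, `R ↦ (Rˣ)^ι`. -/
def torus (K : Type u) [Field K] (ι : Type) : CommAlgCat.{u} K ⥤ GrpCat.{u} where
  obj R := GrpCat.of (ι → Rˣ)
  map φ := GrpCat.ofHom (gmMap ι φ.hom.toRingHom)
  map_id _ := rfl
  map_comp _ _ := rfl

/-- The pull-back of locally constant functions along `Spec S → Spec R`. -/
def constMap (G : Type*) [Group G] {R S : Type*} [CommRing R] [CommRing S] (φ : R →+* S) :
    LocallyConstant (PrimeSpectrum R) G →* LocallyConstant (PrimeSpectrum S) G where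
  toFun σ := σ.comap ⟨PrimeSpectrum.comap φ, PrimeSpectrum.continuous_comap φ⟩
  map_one' := rfl
  map_mul' _ _ := rfl

/-- The constant group scheme attached to an abstract group `G`:
`R ↦ {locally constant functions Spec R → G}`. -/
def constGroup (K : Type u) [Field K] (G : Type) [Group G] : CommAlgCat.{u} K ⥤ GrpCat.{u} where
  obj R := GrpCat.of (LocallyConstant (PrimeSpectrum R) G)
  map φ := GrpCat.ofHom (constMap G φ.hom.toRingHom)
  map_id _ := rfl
  map_comp _ _ := rfl

/-- The direct product of two group functors. -/
def prodGroup {K : Type u} [Field K] (N H : CommAlgCat.{u} K ⥤ GrpCat.{u}) :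
    CommAlgCat.{u} K ⥤ GrpCat.{u} where
  obj R := GrpCat.of (N.obj R × H.obj R)
  map φ := GrpCat.ofHom ((N.map φ).hom.prodMap (H.map φ).hom)
  map_id R := by ext x : 2; simp
  map_comp φ ψ := by ext x : 2; simp; rfl

/-! ### The permutation action of a constant group on a torus -/

section Glue

variable {G : Type*} {R S : Type*} [CommRing R] [CommRing S]

/-- The idempotent of `R` which is `1` on the clopen set `{σ = g}` and `0` outside. -/
def locIdem (σ : LocallyConstant (PrimeSpectrum R) G) (g : G) : R :=
  (PrimeSpectrum.isIdempotentElemEquivClopens.symm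
    ⟨σ ⁻¹' {g}, σ.isLocallyConstant.isClopen_fiber g⟩).1

theorem locIdem_isIdem (σ : LocallyConstant (PrimeSpectrum R) G) (g : G) :
    IsIdempotentElem (locIdem σ g) :=
  (PrimeSpectrum.isIdempotentElemEquivClopens.symm
    ⟨σ ⁻¹' {g}, σ.isLocallyConstant.isClopen_fiber g⟩).2

theorem mem_basicOpen_locIdem (σ : LocallyConstant (PrimeSpectrum R) G) (g : G)
    (p : PrimeSpectrum R) : locIdem σ g ∉ p.asIdeal ↔ σ p = g := by
  have := PrimeSpectrum.basicOpen_isIdempotentElemEquivClopens_symm (R := R)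
    ⟨σ ⁻¹' {g}, σ.isLocallyConstant.isClopen_fiber g⟩
  have h2 : p ∈ PrimeSpectrum.basicOpen (locIdem σ g) ↔
      p ∈ (⟨σ ⁻¹' {g}, σ.isLocallyConstant.isClopen_fiber g⟩ :
        TopologicalSpace.Clopens (PrimeSpectrum R)).toOpens := by
    rw [← this]; rfl
  rw [PrimeSpectrum.mem_basicOpen] at h2
  exact h2

open Classical in
theorem algebraMap_locIdem (σ : LocallyConstant (PrimeSpectrum R) G) (g : G)
    (p : PrimeSpectrum R) :
    algebraMap R (Localization.AtPrime p.asIdeal) (locIdem σ g) = if σ p = g then 1 else 0 := by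
  have hid := (locIdem_isIdem σ g).map (algebraMap R (Localization.AtPrime p.asIdeal))
  have hu : ∀ e : R, IsIdempotentElem e → e ∉ p.asIdeal →
      algebraMap R (Localization.AtPrime p.asIdeal) e = 1 := fun e he hep => by
    have hunit : IsUnit (algebraMap R (Localization.AtPrime p.asIdeal) e) :=
      IsLocalization.map_units (M := p.asIdeal.primeCompl) _ ⟨e, hep⟩
    exact hunit.mul_left_cancel (by rw [mul_one, ← map_mul, he.eq])
  split_ifs with h
  · exact hu _ (locIdem_isIdem σ g) ((mem_basicOpen_locIdem σ g p).2 h)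
  · have hmem : locIdem σ g ∈ p.asIdeal := by
      by_contra hc
      exact h ((mem_basicOpen_locIdem σ g p).1 hc)
    have h1 : 1 - locIdem σ g ∉ p.asIdeal := fun hc =>
      p.2.ne_top ((Ideal.eq_top_iff_one _).2 (by simpa using p.asIdeal.add_mem hc hmem))
    have := hu _ (locIdem_isIdem σ g).one_sub h1
    rw [map_sub, map_one] at this
    simpa using this

theorem eq_of_forall_localization {x y : R}
    (h : ∀ p : PrimeSpectrum R, algebraMap R (Localization.AtPrime p.asIdeal) x =
      algebraMap R (Localization.AtPrime p.asIdeal) y) : x = y := by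
  apply MaximalSpectrum.toPiLocalization_injective R
  funext I
  exact h ⟨I.asIdeal, I.isMaximal.isPrime⟩

variable [Fintype G]

theorem glue_aux (σ : LocallyConstant (PrimeSpectrum R) G) (r : G → R) (p : PrimeSpectrum R) :
    algebraMap R (Localization.AtPrime p.asIdeal) (∑ g, locIdem σ g * r g) =
      algebraMap R (Localization.AtPrime p.asIdeal) (r (σ p)) := by
  classical
  simp [map_sum, map_mul, algebraMap_locIdem]

/-- For a locally constant `σ : Spec R → G`, the ring homomorphism `R^G → R` which sends `(r_g)` to
the function on `Spec R` that is equal to `r_g` on the clopen set `{σ = g}`, for every `g`. -/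
def glue (σ : LocallyConstant (PrimeSpectrum R) G) : (G → R) →+* R where
  toFun r := ∑ g, locIdem σ g * r g
  map_one' := eq_of_forall_localization fun p => by rw [glue_aux]; simp
  map_zero' := by simp
  map_mul' r s := eq_of_forall_localization fun p => by
    rw [map_mul, glue_aux, glue_aux, glue_aux]; simp
  map_add' r s := by simp [mul_add, Finset.sum_add_distrib]

theorem glue_local (σ : LocallyConstant (PrimeSpectrum R) G) (r : G → R) (p : PrimeSpectrum R) :
    algebraMap R (Localization.AtPrime p.asIdeal) (glue σ r) =
      algebraMap R (Localization.AtPrime p.asIdeal) (r (σ p)) :=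
  glue_aux σ r p

theorem algebraMap_eq_of_comap (φ : R →+* S) (q : PrimeSpectrum S) {x y : R}
    (h : algebraMap R (Localization.AtPrime (PrimeSpectrum.comap φ q).asIdeal) x =
      algebraMap R (Localization.AtPrime (PrimeSpectrum.comap φ q).asIdeal) y) :
    algebraMap S (Localization.AtPrime q.asIdeal) (φ x) =
      algebraMap S (Localization.AtPrime q.asIdeal) (φ y) := by
  rw [IsLocalization.eq_iff_exists (PrimeSpectrum.comap φ q).asIdeal.primeCompl] at h
  obtain ⟨c, hc⟩ := h
  rw [IsLocalization.eq_iff_exists q.asIdeal.primeCompl]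
  exact ⟨⟨φ c, c.2⟩, by simpa only [map_mul] using congrArg φ hc⟩

variable [Group G] {ι : Type*} [MulAction G ι]

/-- The action of a locally constant `σ : Spec R → G` on `(Rˣ)^ι`, where `G` acts on `ι`:
`(σ t)_i = t_{g⁻¹ i}` on the clopen set `{σ = g}`, for every `g`. -/
def permTorus (σ : LocallyConstant (PrimeSpectrum R) G) (t : ι → Rˣ) : ι → Rˣ :=
  fun i => Units.map (glue σ : (G → R) →* R) (MulEquiv.piUnits.symm fun g : G => t (g⁻¹ • i))

theorem permTorus_local (σ : LocallyConstant (PrimeSpectrum R) G) (t : ι → Rˣ) (i : ι)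
    (p : PrimeSpectrum R) :
    algebraMap R (Localization.AtPrime p.asIdeal) (permTorus σ t i : Rˣ) =
      algebraMap R (Localization.AtPrime p.asIdeal) (t ((σ p)⁻¹ • i) : Rˣ) :=
  glue_local σ _ p

theorem permTorus_one (t : ι → Rˣ) :
    permTorus (1 : LocallyConstant (PrimeSpectrum R) G) t = t := by
  funext i
  refine Units.ext (eq_of_forall_localization fun p => ?_)
  rw [permTorus_local]
  simp

theorem permTorus_mul (σ τ : LocallyConstant (PrimeSpectrum R) G) (t : ι → Rˣ) :
    permTorus (σ * τ) t = permTorus σ (permTorus τ t) := by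
  funext i
  refine Units.ext (eq_of_forall_localization fun p => ?_)
  rw [permTorus_local, permTorus_local, permTorus_local]
  simp [mul_smul]

theorem permTorus_mul_right (σ : LocallyConstant (PrimeSpectrum R) G) (s t : ι → Rˣ) :
    permTorus σ (s * t) = permTorus σ s * permTorus σ t := by
  funext i
  refine Units.ext (eq_of_forall_localization fun p => ?_)
  rw [permTorus_local, Pi.mul_apply, Pi.mul_apply, Units.val_mul, Units.val_mul, map_mul, map_mul,
    permTorus_local, permTorus_local]

theorem gmMap_permTorus (φ : R →+* S) (σ : LocallyConstant (PrimeSpectrum R) G) (t : ι → Rˣ) :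
    gmMap ι φ (permTorus σ t) = permTorus (constMap G φ σ) (gmMap ι φ t) := by
  funext i
  refine Units.ext (eq_of_forall_localization fun q => ?_)
  rw [permTorus_local]
  exact algebraMap_eq_of_comap φ q (permTorus_local σ t i _)

variable (G R ι) in
/-- The action by group automorphisms of the constant group scheme of `G` on the torus `G_m^ι`. -/
def permAction : LocallyConstant (PrimeSpectrum R) G →* MulAut (ι → Rˣ) where
  toFun σ :=
    { toFun := permTorus σ
      invFun := permTorus σ⁻¹
      left_inv := fun t => by rw [← permTorus_mul, inv_mul_cancel, permTorus_one]
      right_inv := fun t => by rw [← permTorus_mul, mul_inv_cancel, permTorus_one]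
      map_mul' := permTorus_mul_right σ }
  map_one' := by ext1 t; exact permTorus_one t
  map_mul' σ τ := by ext1 t; exact permTorus_mul σ τ t

end Glue

/-- The semidirect product `G_m^ι ⋊ G` of a torus by a finite constant group scheme which permutes
the coordinates through an action of `G` on `ι`. -/
def torusSemidirect (K : Type u) [Field K] (ι G : Type) [Fintype G] [Group G] [MulAction G ι] :
    CommAlgCat.{u} K ⥤ GrpCat.{u} where
  obj R := GrpCat.of ((ι → Rˣ) ⋊[permAction G R ι] LocallyConstant (PrimeSpectrum R) G)
  map φ := GrpCat.ofHom (SemidirectProduct.map (gmMap ι φ.hom.toRingHom)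
    (constMap G φ.hom.toRingHom) fun σ => by
      ext1 t; exact gmMap_permTorus φ.hom.toRingHom σ t)
  map_id _ := rfl
  map_comp _ _ := rfl

/-- The inclusion of the torus as the normal factor of the semidirect product. -/
def torusInl (K : Type u) [Field K] (ι G : Type) [Fintype G] [Group G] [MulAction G ι] :
    torus K ι ⟶ torusSemidirect K ι G where
  app R := GrpCat.ofHom SemidirectProduct.inl
  naturality R S φ := by
    ext t : 2
    exact SemidirectProduct.ext rfl rfl

/-! ### The identity component -/

section IdentityComponent

variable {K : Type u} [Field K] {G : CommAlgCat.{u} K ⥤ GrpCat.{u}} {H : CommAlgCat.{u} K}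

/-- If `G = Spec H`, the continuous map `Spec R → Spec H` underlying an `R`-point `g ∈ G(R)`. -/
def classifyingMap (r : (G ⋙ forget GrpCat.{u}).CorepresentableBy H) {R : CommAlgCat.{u} K}
    (g : G.obj R) : PrimeSpectrum R → PrimeSpectrum H :=
  PrimeSpectrum.comap (r.homEquiv.symm g : H ⟶ R).hom.toRingHom

/-- If `G = Spec H`, the identity point of `Spec H`: the image of `Spec K` under `1 ∈ G(K)`. -/
def identityPoint (r : (G ⋙ forget GrpCat.{u}).CorepresentableBy H) : PrimeSpectrum H :=
  classifyingMap r (1 : G.obj (CommAlgCat.of K K)) ⊥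

/-- `i : N → G` identifies `N` with the identity component of the affine algebraic group `G`, that is,
`G` is represented by a finitely generated `K`-algebra `H`, and `i` is an isomorphism of `N` onto the
connected component of the identity in `Spec H`. As `H` is Noetherian, this component is an open
subscheme of `Spec H`; its `R`-points are the morphisms `Spec R → Spec H` with image inside it. -/
def IsIdentityComponent {N : CommAlgCat.{u} K ⥤ GrpCat.{u}} (i : N ⟶ G) : Prop :=
  ∃ (H : CommAlgCat.{u} K) (r : (G ⋙ forget GrpCat.{u}).CorepresentableBy H),
    Algebra.FiniteType K H ∧ ∀ R : CommAlgCat.{u} K, Function.Injective (i.app R) ∧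
      Set.range (i.app R) =
        {g : G.obj R | ∀ p, classifyingMap r g p ∈ connectedComponent (identityPoint r)}

end IdentityComponent

end EvolutionAlgebra

end

open EvolutionAlgebra

noncomputable section

namespace EvolutionAlgebra

/-! ### Locally constant functions and idempotents -/

section Glue

variable {G : Type*} {R S : Type*} [CommRing R] [CommRing S]

/-! Let `b` be a natural basis and `u i = b i * b i`. Perfectness makes the squares span, so `u` is
again a basis (`exists_basis_mul_eq`), and in coordinates the product is entrywise multiplication
from `b`-coordinates to `u`-coordinates.

Let `a`, `c` be the matrices of `f₂`, `f₃`. The ternary identity on `b i * b j = 0` says `a k i * c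
k j = 0` for `i ≠ j`. Over a local ring, invertibility then forces both matrices to be monomial with
the same permutation. Over a general ring this holds at every prime, and the permutation is locally
constant on the spectrum (`exists_monomialMatrix_of_mul_eq_zero`). The values on the squares `u i`
determine `f₁` from `f₂` and `f₃`. So a ternary automorphism amounts to two families of units and
one locally constant permutation, which is a point of the semidirect product
(`ternaryHom_bijective`), naturally in the ring (`extendEquiv_monomialHom`).

The semidirect product is represented by a finite product of Laurent polynomial rings, one for each
group element (`pointHom_bijective`). Each factor is a domain, so its spectrum is irreducible, and
the identity component is the factor indexed by `1`
(`connectedComponent_identityPoint_torusSemidirect`). The isomorphism carries this over to the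
ternary automorphisms (`IsIdentityComponent.comp_iso`).

Identities involving `glue` are checked in the local rings, where a locally constant function
becomes a single group element. -/

theorem locIdem_eq_of_forall {σ : LocallyConstant (PrimeSpectrum R) G} {g : G} {x : R}
    (hx : IsIdempotentElem x) (h : ∀ p : PrimeSpectrum R, x ∉ p.asIdeal ↔ σ p = g) :
    locIdem σ g = x := by
  refine PrimeSpectrum.basicOpen_injOn_isIdempotentElem (locIdem_isIdem σ g) hx ?_
  ext p
  exact (mem_basicOpen_locIdem σ g p).trans (h p).symm

theorem locIdem_injective :
    Function.Injective (locIdem : LocallyConstant (PrimeSpectrum R) G → G → R) := fun σ τ h => by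
  ext p
  exact ((mem_basicOpen_locIdem τ (σ p) p).1
    (h ▸ (mem_basicOpen_locIdem σ (σ p) p).2 rfl)).symm

/-- A complete family of orthogonal idempotents comes from a locally constant function. -/
theorem exists_locIdem_eq [Fintype G] {x : G → R} (hx : CompleteOrthogonalIdempotents x) :
    ∃ σ : LocallyConstant (PrimeSpectrum R) G, locIdem σ = x := by
  have hex : ∀ p : PrimeSpectrum R, ∃ g, x g ∉ p.asIdeal := fun p => by
    by_contra! h
    exact p.2.ne_top ((Ideal.eq_top_iff_one _).2
      (hx.complete ▸ p.asIdeal.sum_mem fun g _ => h g))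
  choose f hf using hex
  have huniq : ∀ p g, x g ∉ p.asIdeal ↔ f p = g := fun p g => by
    refine ⟨fun hg => ?_, fun hg => hg ▸ hf p⟩
    by_contra hne
    have h0 : x (f p) * x g ∈ p.asIdeal := by
      rw [hx.ortho hne]; exact p.asIdeal.zero_mem
    exact (p.2.mem_or_mem h0).elim (hf p) hg
  have hloc : IsLocallyConstant f := by
    refine IsLocallyConstant.iff_isOpen_fiber.2 fun g => ?_
    have : f ⁻¹' {g} = PrimeSpectrum.basicOpen (x g) := by
      ext p
      exact (huniq p g).symm
    rw [this]
    exact (PrimeSpectrum.basicOpen (x g)).2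
  exact ⟨⟨f, hloc⟩, funext fun g => locIdem_eq_of_forall (hx.idem g) (huniq · g)⟩

variable [Fintype G]

theorem glue_const (σ : LocallyConstant (PrimeSpectrum R) G) (r : R) :
    glue σ (fun _ => r) = r :=
  eq_of_forall_localization fun p => glue_local σ _ p

theorem glue_single [DecidableEq G] (σ : LocallyConstant (PrimeSpectrum R) G) (g : G) :
    glue σ (Pi.single g 1) = locIdem σ g := by
  change ∑ h, locIdem σ h * (Pi.single g 1 : G → R) h = _
  simp [Pi.single_apply]

theorem map_glue [Group G] (φ : R →+* S) (σ : LocallyConstant (PrimeSpectrum R) G) (r : G → R) :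
    φ (glue σ r) = glue (constMap G φ σ) fun g => φ (r g) := by
  refine eq_of_forall_localization fun q => ?_
  rw [glue_local]
  exact algebraMap_eq_of_comap φ q (glue_local σ r _)

end Glue

/-! ### The coordinate ring of a torus -/

section Laurent

variable (K : Type u) [Field K] (ι : Type) [Fintype ι]

/-- The ring of Laurent polynomials in a finite set of variables. -/
abbrev Laurent : Type u :=
  Localization.Away (∏ i : ι, (MvPolynomial.X i : MvPolynomial ι K))

instance : IsDomain (Laurent K ι) :=
  IsLocalization.isDomain_localization <| powers_le_nonZeroDivisors_of_noZeroDivisors <|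
    Finset.prod_ne_zero_iff.2 fun i _ => MvPolynomial.X_ne_zero i

variable {K ι}
variable {R : Type*} [CommRing R] [Algebra K R]

/-- The point of the torus with the given unit coordinates, as a map on Laurent polynomials. -/
def laurentLift (t : ι → Rˣ) : Laurent K ι →ₐ[K] R :=
  IsLocalization.liftAlgHom (M := Submonoid.powers (∏ i : ι, (MvPolynomial.X i : MvPolynomial ι K)))
    (f := MvPolynomial.aeval fun i => (t i : R)) <| by
      rintro ⟨_, m, rfl⟩
      simp only [map_pow, map_prod, MvPolynomial.aeval_X]
      exact (IsUnit.prod_univ_iff.2 fun i => (t i).isUnit).pow m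

theorem laurentLift_X (t : ι → Rˣ) (i : ι) :
    laurentLift t (algebraMap (MvPolynomial ι K) (Laurent K ι) (MvPolynomial.X i)) = t i := by
  simp [laurentLift]

theorem laurent_hom_ext {f g : Laurent K ι →ₐ[K] R}
    (h : ∀ i, f (algebraMap (MvPolynomial ι K) _ (MvPolynomial.X i)) =
      g (algebraMap (MvPolynomial ι K) _ (MvPolynomial.X i))) : f = g :=
  IsLocalization.algHom_ext (Submonoid.powers (∏ i : ι, (MvPolynomial.X i : MvPolynomial ι K)))
    (MvPolynomial.algHom_ext h)

/-- A product is a unit only if every factor is, so inverting the product of the variables inverts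
each variable; their images are the coordinates of the point. -/
theorem exists_laurentLift_eq (f : Laurent K ι →ₐ[K] R) : ∃ t : ι → Rˣ, laurentLift t = f := by
  have hu : ∀ i, IsUnit (algebraMap (MvPolynomial ι K) (Laurent K ι) (MvPolynomial.X i)) := by
    have := IsLocalization.Away.algebraMap_isUnit (S := Laurent K ι)
      (∏ i : ι, (MvPolynomial.X i : MvPolynomial ι K))
    rw [map_prod] at this
    exact IsUnit.prod_univ_iff.1 this
  refine ⟨fun i => ((hu i).map f).unit, laurent_hom_ext fun i => ?_⟩
  rw [laurentLift_X]
  rfl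

end Laurent

/-! ### The coordinate ring of the semidirect product -/

section Coordinate

variable {K : Type u} [Field K] {ι : Type} [Fintype ι] {G : Type} [Fintype G]
  {R S : Type*} [CommRing R] [Algebra K R] [CommRing S] [Algebra K S]

/-- The map on coordinate rings attached to a point `(t, σ)` of the product of a torus and a finite
constant group scheme. -/
def pointHom (t : ι → Rˣ) (σ : LocallyConstant (PrimeSpectrum R) G) :
    (G → Laurent K ι) →ₐ[K] R :=
  { (glue σ).comp (RingHom.pi fun g =>
      (laurentLift t : Laurent K ι →ₐ[K] R).toRingHom.comp (Pi.evalRingHom _ g)) with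
    commutes' := fun c => by
      change glue σ (fun _ => laurentLift t (algebraMap K _ c)) = _
      rw [AlgHom.commutes, glue_const] }

theorem pointHom_apply (t : ι → Rˣ) (σ : LocallyConstant (PrimeSpectrum R) G)
    (x : G → Laurent K ι) : pointHom t σ x = glue σ fun g => laurentLift t (x g) :=
  rfl

/-- Constant families see only `t`, and the standard idempotents see only `σ` (`pointHom_single`);
together they recover the point from its homomorphism. -/
theorem pointHom_const (t : ι → Rˣ) (σ : LocallyConstant (PrimeSpectrum R) G)
    (x : Laurent K ι) : pointHom t σ (fun _ => x) = laurentLift t x := by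
  rw [pointHom_apply, glue_const]

theorem pointHom_single [DecidableEq G] (t : ι → Rˣ) (σ : LocallyConstant (PrimeSpectrum R) G)
    (g : G) : pointHom t σ (Pi.single g (1 : Laurent K ι)) = locIdem σ g := by
  rw [pointHom_apply, ← glue_single]
  congr 1
  ext h
  obtain rfl | hne := eq_or_ne h g
  · simp
  · simp [hne]

theorem comp_pointHom [Group G] (φ : R →ₐ[K] S) (t : ι → Rˣ)
    (σ : LocallyConstant (PrimeSpectrum R) G) :
    φ.comp (pointHom t σ : (G → Laurent K ι) →ₐ[K] R) =
      pointHom (gmMap ι φ.toRingHom t) (constMap G φ.toRingHom σ) := by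
  have h : φ.comp (laurentLift t : Laurent K ι →ₐ[K] R) = laurentLift (gmMap ι φ.toRingHom t) :=
    laurent_hom_ext fun i => by
      rw [AlgHom.comp_apply, laurentLift_X, laurentLift_X]
      rfl
  ext1 x
  simp only [AlgHom.comp_apply, pointHom_apply, ← h]
  exact map_glue φ.toRingHom σ _

theorem pointHom_bijective : Function.Bijective
    fun x : (ι → Rˣ) × LocallyConstant (PrimeSpectrum R) G =>
      (pointHom x.1 x.2 : (G → Laurent K ι) →ₐ[K] R) := by
  classical
  constructor
  · rintro ⟨t, σ⟩ ⟨s, τ⟩ h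
    refine Prod.ext (funext fun i => Units.ext ?_) (locIdem_injective (funext fun g => ?_))
    · simpa [pointHom_const, laurentLift_X] using
        DFunLike.congr_fun h fun _ => algebraMap (MvPolynomial ι K) _ (MvPolynomial.X i)
    · simpa [pointHom_single] using DFunLike.congr_fun h (Pi.single g 1)
  · intro f
    -- The images of the standard idempotents give `σ`, and the restriction of `f` to constant
    -- families gives `t`.
    have hx := (CompleteOrthogonalIdempotents.single fun _ : G => Laurent K ι).map f.toRingHom
    obtain ⟨σ, hσ⟩ := exists_locIdem_eq hx
    obtain ⟨t, ht⟩ := exists_laurentLift_eq (f.comp (Pi.constAlgHom K G (Laurent K ι)))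
    refine ⟨(t, σ), AlgHom.ext fun x => ?_⟩
    have hsum : x = ∑ g, Pi.single g (1 : Laurent K ι) * (fun _ => x g) := by
      ext h
      simp [Finset.sum_apply, Pi.single_apply]
    change ∑ g, locIdem σ g * laurentLift t (x g) = f x
    conv_rhs => rw [hsum, map_sum]
    refine Finset.sum_congr rfl fun g _ => ?_
    rw [map_mul, ht, hσ]
    rfl

end Coordinate

/-! ### Representability and identity component of the semidirect product -/

section Representability

variable (K : Type u) [Field K] (ι G : Type) [Fintype ι] [Fintype G] [Group G] [MulAction G ι]

/-- The bijection between homomorphisms out of the coordinate ring and points. -/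
def torusSemidirectEquiv (R : CommAlgCat.{u} K) :
    (CommAlgCat.of K (G → Laurent K ι) ⟶ R) ≃
      (ι → Rˣ) ⋊[permAction G R ι] LocallyConstant (PrimeSpectrum R) G :=
  ((SemidirectProduct.equivProd.trans (Equiv.ofBijective _ pointHom_bijective)).trans
    ⟨CommAlgCat.ofHom, CommAlgCat.Hom.hom, fun _ => rfl, fun _ => rfl⟩).symm

/-- The semidirect product of a torus and a finite constant group scheme is affine. -/
def torusSemidirectCorepresentableBy :
    (torusSemidirect K ι G ⋙ forget GrpCat.{u}).CorepresentableBy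
      (CommAlgCat.of K (G → Laurent K ι)) where
  homEquiv {R} := torusSemidirectEquiv K ι G R
  homEquiv_comp {R S} φ f := by
    obtain ⟨x, rfl⟩ := (torusSemidirectEquiv K ι G R).symm.surjective f
    have h : (torusSemidirectEquiv K ι G R).symm x ≫ φ = (torusSemidirectEquiv K ι G S).symm
        (((torusSemidirect K ι G).map φ).hom x) :=
      CommAlgCat.hom_ext (comp_pointHom φ.hom x.left x.right)
    exact (congrArg (torusSemidirectEquiv K ι G S) h).trans
      ((Equiv.apply_symm_apply _ _).trans (congrArg ((torusSemidirect K ι G).map φ).hom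
        (Equiv.apply_symm_apply (torusSemidirectEquiv K ι G R) x).symm))

variable {K ι G}
-- The idempotent of the factor `g` pulls back along the point `x` to `locIdem x.right g`, so the
-- permutation part of `x` records which factor each prime is sent to.
theorem single_notMem_classifyingMap [DecidableEq G] {R : CommAlgCat.{u} K}
    (x : (torusSemidirect K ι G).obj R) (p : PrimeSpectrum R) (g : G) :
    (Pi.single g 1 : G → Laurent K ι) ∉
      (classifyingMap (torusSemidirectCorepresentableBy K ι G) x p).asIdeal ↔ x.right p = g := by
  rw [← mem_basicOpen_locIdem, ← pointHom_single (K := K) x.left]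
  rfl

/-- The clopen subset of the spectrum of a power of a domain given by one of the factors. -/
theorem basicOpen_single_isPreconnected {κ : Type*} [DecidableEq κ] (D : Type*) [CommRing D]
    [IsDomain D]
    (g : κ) : _root_.IsPreconnected
    (PrimeSpectrum.basicOpen (Pi.single g 1 : κ → D) : Set (PrimeSpectrum (κ → D))) := by
  have hP : (RingHom.ker (Pi.evalRingHom (fun _ : κ => D) g)).IsPrime := RingHom.ker_isPrime _
  -- The kernel of evaluation at `g` is the generic point of this factor, and the closure of a point
  -- is connected.
  have : (PrimeSpectrum.basicOpen (Pi.single g 1 : κ → D) : Set (PrimeSpectrum (κ → D))) =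
      closure {⟨_, hP⟩} := by
    rw [PrimeSpectrum.closure_singleton]
    ext q
    have hidem : (Pi.single g 1 : κ → D) * (1 - Pi.single g 1) = 0 := by
      ext h
      by_cases hh : h = g <;> simp [hh]
    constructor
    · intro hq x hx
      have : (Pi.single g 1 : κ → D) * x = 0 := by
        ext h
        obtain rfl | hne := eq_or_ne h g
        · simpa using hx
        · simp [hne]
      exact (q.2.mem_or_mem (this ▸ q.asIdeal.zero_mem)).resolve_left hq
    · intro hq hmem
      have h1 : (1 - Pi.single g 1 : κ → D) ∈ q.asIdeal := hq (by simp [RingHom.mem_ker])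
      exact q.2.ne_top ((Ideal.eq_top_iff_one _).2 (by simpa using q.asIdeal.add_mem h1 hmem))
  rw [this]
  exact isPreconnected_singleton.closure

variable (K ι G) in
-- A connected clopen set is the component of each of its points.
theorem connectedComponent_identityPoint_torusSemidirect [DecidableEq G] :
    connectedComponent (identityPoint (torusSemidirectCorepresentableBy K ι G)) =
      PrimeSpectrum.basicOpen (Pi.single 1 1 : G → Laurent K ι) := by
  have hmem : identityPoint (torusSemidirectCorepresentableBy K ι G) ∈
      PrimeSpectrum.basicOpen (Pi.single 1 1 : G → Laurent K ι) :=
    (single_notMem_classifyingMap _ _ _).2 rfl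
  have hidem : IsIdempotentElem (Pi.single 1 1 : G → Laurent K ι) :=
    (CompleteOrthogonalIdempotents.single fun _ : G => Laurent K ι).idem 1
  refine (IsClopen.connectedComponent_subset ?_ hmem).antisymm
    ((basicOpen_single_isPreconnected _ 1).subset_connectedComponent hmem)
  exact PrimeSpectrum.isClopen_iff.2 ⟨_, hidem, rfl⟩

variable (K ι G) in
theorem torusInl_isIdentityComponent : IsIdentityComponent (torusInl K ι G) := by
  classical
  have h1 : Algebra.FiniteType K (Laurent K ι) :=
    Algebra.FiniteType.trans (S := MvPolynomial ι K) inferInstance inferInstance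
  have h2 : Algebra.FiniteType K (G → Laurent K ι) :=
    Algebra.FiniteType.trans (S := Laurent K ι) h1 inferInstance
  refine ⟨_, torusSemidirectCorepresentableBy K ι G, h2,
    fun R => ⟨SemidirectProduct.inl_injective, ?_⟩⟩
  rw [connectedComponent_identityPoint_torusSemidirect]
  ext x
  constructor
  · rintro ⟨t, rfl⟩ p
    exact (single_notMem_classifyingMap _ _ _).2 rfl
  · intro hx
    have h1 : x.right = 1 := LocallyConstant.ext fun p =>
      (single_notMem_classifyingMap x p 1).1 (hx p)
    exact ⟨x.left, SemidirectProduct.ext rfl h1.symm⟩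

end Representability

/-! ### Transport of the identity component along an isomorphism -/

section Transport

variable {K : Type u} [Field K] {N G G' : CommAlgCat.{u} K ⥤ GrpCat.{u}}

theorem IsIdentityComponent.comp_iso {i : N ⟶ G} (hi : IsIdentityComponent i) (e : G ≅ G') :
    IsIdentityComponent (i ≫ e.hom) := by
  obtain ⟨H, r, hH, h⟩ := hi
  let E : (R : CommAlgCat.{u} K) → G.obj R ≃ G'.obj R := fun R => (e.app R).groupIsoToMulEquiv
  let r' : (G' ⋙ forget GrpCat.{u}).CorepresentableBy H :=
    r.ofIso (Functor.isoWhiskerRight e (forget GrpCat.{u}))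
  -- With the same algebra `H` representing both functors, corresponding points have the same map of
  -- spectra; hence the component does not change.
  have hr' : ∀ (R : CommAlgCat.{u} K) (g : G.obj R),
      classifyingMap r' (E R g) = classifyingMap r g := fun R g => by
    have : r'.homEquiv.symm (E R g) = r.homEquiv.symm g := by
      rw [Equiv.symm_apply_eq]
      change E R g = E R (r.homEquiv (r.homEquiv.symm g))
      rw [Equiv.apply_symm_apply]
    rw [classifyingMap, this, classifyingMap]
  have hid : identityPoint r' = identityPoint r := by
    rw [identityPoint, identityPoint, ← hr']
    congr 2
    exact (map_one (e.hom.app _).hom).symm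
  refine ⟨H, r', hH, fun R => ⟨(E R).injective.comp (h R).1, ?_⟩⟩
  ext g
  obtain ⟨g, rfl⟩ := (E R).surjective g
  rw [Set.mem_ofPred_eq, hid, hr']
  refine Iff.trans ?_ (Set.ext_iff.1 (h R).2 g)
  exact ⟨fun ⟨x, hx⟩ => ⟨x, (E R).injective hx⟩, fun ⟨x, hx⟩ => ⟨x, congrArg (E R) hx⟩⟩

end Transport

/-! ### Locally monomial matrices -/

section Monomial

variable {ι : Type*} [Fintype ι] [DecidableEq ι] {R S : Type*} [CommRing R] [CommRing S]

/-- The matrix with entry `t k` at `(k, σ i)` on the clopen set where `σ i = k`, and `0` elsewhere. -/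
def monomialMatrix (t : ι → Rˣ) (σ : LocallyConstant (PrimeSpectrum R) (Equiv.Perm ι)) :
    Matrix ι ι R :=
  Matrix.of fun k i => t k * glue σ fun g => if g i = k then 1 else 0

/-- In the local ring at `p` this is an ordinary monomial matrix with permutation `σ p`. -/
theorem monomialMatrix_local (t : ι → Rˣ) (σ : LocallyConstant (PrimeSpectrum R) (Equiv.Perm ι))
    (k i : ι) (p : PrimeSpectrum R) :
    algebraMap R (Localization.AtPrime p.asIdeal) (monomialMatrix t σ k i) =
      if σ p i = k then algebraMap R (Localization.AtPrime p.asIdeal) (t k) else 0 := by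
  rw [monomialMatrix, Matrix.of_apply, map_mul, glue_local]
  split_ifs <;> simp

theorem monomialMatrix_one : monomialMatrix (1 : ι → Rˣ) 1 = 1 := by
  ext k i
  refine eq_of_forall_localization fun p => ?_
  rw [monomialMatrix_local, Matrix.one_apply]
  obtain rfl | h := eq_or_ne i k
  · simp
  · simp [h, h.symm]

theorem monomialMatrix_mul (t s : ι → Rˣ)
    (σ τ : LocallyConstant (PrimeSpectrum R) (Equiv.Perm ι)) :
    monomialMatrix (t * permTorus σ s) (σ * τ) = monomialMatrix t σ * monomialMatrix s τ := by
  ext k i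
  refine eq_of_forall_localization fun p => ?_
  -- Row `k` of the left factor is supported at column `(σ p)⁻¹ k`, so one summand survives; its
  -- coefficient from `s` is the one in the twisted product `t * permTorus σ s`.
  rw [monomialMatrix_local, Matrix.mul_apply, map_sum, Pi.mul_apply, Units.val_mul, map_mul,
    permTorus_local, Finset.sum_eq_single ((σ p)⁻¹ k)]
  · have : (σ * τ) p i = k ↔ τ p i = (σ p)⁻¹ k := by
      rw [Equiv.Perm.eq_inv_iff_eq]
      rfl
    rw [map_mul, monomialMatrix_local, monomialMatrix_local,
      if_pos (show σ p ((σ p)⁻¹ k) = k from (σ p).apply_symm_apply k),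
      if_congr this rfl rfl, mul_ite, mul_zero]
    rfl
  · intro j _ hj
    rw [map_mul, monomialMatrix_local, if_neg, zero_mul]
    rintro rfl
    simp at hj
  · simp

/-- Locally each row has a single nonzero entry because `σ p` is injective. This is the ternary
identity on basis vectors in matrix form. -/
theorem monomialMatrix_mul_apply (t s : ι → Rˣ)
    (σ : LocallyConstant (PrimeSpectrum R) (Equiv.Perm ι)) (k i j : ι) :
    monomialMatrix t σ k i * monomialMatrix s σ k j =
      if i = j then monomialMatrix (t * s) σ k i else 0 := by
  refine eq_of_forall_localization fun p => ?_
  rw [map_mul, monomialMatrix_local, monomialMatrix_local]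
  obtain rfl | hij := eq_or_ne i j
  · rw [if_pos rfl, monomialMatrix_local]
    split_ifs <;> simp
  · rw [if_neg hij, map_zero]
    split_ifs with h1 h2
    · exact absurd ((σ p).injective (h1.trans h2.symm)) hij
    all_goals simp

/-- Units are nonzero in a local ring, so the support of the matrix determines `σ`; the entries on
the support then determine `t`. -/
theorem monomialMatrix_injective {t s : ι → Rˣ}
    {σ τ : LocallyConstant (PrimeSpectrum R) (Equiv.Perm ι)}
    (h : monomialMatrix t σ = monomialMatrix s τ) : t = s ∧ σ = τ := by
  have key : ∀ p k i, (if σ p i = k then algebraMap R (Localization.AtPrime p.asIdeal) (t k)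
      else 0) = if τ p i = k then algebraMap R (Localization.AtPrime p.asIdeal) (s k) else 0 :=
    fun p k i => by rw [← monomialMatrix_local, ← monomialMatrix_local, h]
  have hστ : σ = τ := by
    ext p i
    by_contra hne
    have h0 := key p (σ p i) i
    rw [if_pos rfl, if_neg (Ne.symm hne)] at h0
    exact ((t (σ p i)).isUnit.map (algebraMap R (Localization.AtPrime p.asIdeal))).ne_zero h0
  subst hστ
  refine ⟨funext fun k => Units.ext (eq_of_forall_localization fun p => ?_), rfl⟩
  simpa using key p k ((σ p)⁻¹ k)

theorem map_monomialMatrix (φ : R →+* S) (t : ι → Rˣ)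
    (σ : LocallyConstant (PrimeSpectrum R) (Equiv.Perm ι)) (k i : ι) :
    φ (monomialMatrix t σ k i) = monomialMatrix (gmMap ι φ t) (constMap _ φ σ) k i := by
  rw [monomialMatrix, Matrix.of_apply, map_mul, map_glue]
  simp only [apply_ite φ, map_one, map_zero]
  rfl

theorem exists_isUnit_of_sum_mul_eq_one {κ : Type*} [Fintype κ] [IsLocalRing R] {x y : κ → R}
    (h : ∑ i, x i * y i = 1) : ∃ i, IsUnit (x i) := by
  by_contra! hx
  refine (Ideal.ne_top_iff_one _).1 (IsLocalRing.maximalIdeal.isMaximal R).ne_top ?_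
  rw [← h]
  exact Ideal.sum_mem _ fun i _ =>
    Ideal.mul_mem_right _ _ ((IsLocalRing.mem_maximalIdeal _).2 (hx i))

/-- Over a local ring, invertible matrices `a` and `c` with `a k i * c k j = 0` for `i ≠ j` are
monomial, with the same permutation. -/
theorem exists_perm_of_mul_eq_zero [IsLocalRing R] {a c : Matrix ι ι R} (ha : IsUnit a)
    (hc : IsUnit c) (h : ∀ k i j, i ≠ j → a k i * c k j = 0) :
    ∃ g : Equiv.Perm ι, (∀ i, IsUnit (a (g i) i) ∧ IsUnit (c (g i) i)) ∧
      ∀ k i, g i ≠ k → a k i = 0 ∧ c k i = 0 := by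
  have hrow : ∀ {d : Matrix ι ι R}, IsUnit d → ∀ k, ∃ i, IsUnit (d k i) := fun {d} hd k => by
    obtain ⟨d', hd'⟩ := hd.exists_right_inv
    exact exists_isUnit_of_sum_mul_eq_one (y := fun i => d' i k)
      (by simpa [Matrix.mul_apply] using congrFun (congrFun hd' k) k)
  have hcol : ∀ i, ∃ k, IsUnit (a k i) := fun i => by
    obtain ⟨d', hd'⟩ := ha.exists_left_inv
    refine exists_isUnit_of_sum_mul_eq_one (y := fun k => d' i k) ?_
    simpa [Matrix.mul_apply, mul_comm] using congrFun (congrFun hd' i) i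
  -- A unit of `a` in row `k`, column `f k`, kills every other entry in row `k` of `c`. The
  -- remaining entry of `c` must be a unit, which in turn clears row `k` of `a`.
  choose f hf using hrow ha
  have hc0 : ∀ k j, f k ≠ j → c k j = 0 := fun k j hj => (hf k).mul_right_eq_zero.1 (h k _ j hj)
  have hcu : ∀ k, IsUnit (c k (f k)) := fun k => by
    obtain ⟨i, hi⟩ := hrow hc k
    obtain rfl | hne := eq_or_ne (f k) i
    · exact hi
    · exact absurd (hc0 k i hne) hi.ne_zero
  have ha0 : ∀ k i, f k ≠ i → a k i = 0 := fun k i hi =>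
    (hcu k).mul_left_eq_zero.1 (h k i _ hi.symm)
  have hsurj : Function.Surjective f := fun i => by
    obtain ⟨k, hk⟩ := hcol i
    exact ⟨k, by_contra fun hne => hk.ne_zero (ha0 k i hne)⟩
  -- As `f` sends rows to columns, the required permutation, from columns to rows, is its inverse.
  let F : Equiv.Perm ι := Equiv.ofBijective f (Finite.surjective_iff_bijective.1 hsurj)
  have hF : ∀ i, f (F.symm i) = i := F.apply_symm_apply
  refine ⟨F.symm, fun i => ?_, fun k i hne => ?_⟩
  · have h1 := hf (F.symm i)
    have h2 := hcu (F.symm i)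
    rw [hF] at h1 h2
    exact ⟨h1, h2⟩
  · have hk : f k ≠ i := fun h => hne (by rw [← h]; exact F.symm_apply_apply k)
    exact ⟨ha0 k i hk, hc0 k i hk⟩

theorem isUnit_of_forall_localization {x : R}
    (h : ∀ p : PrimeSpectrum R, IsUnit (algebraMap R (Localization.AtPrime p.asIdeal) x)) :
    IsUnit x := by
  by_contra hx
  obtain ⟨m, hm, hxm⟩ := exists_max_ideal_of_mem_nonunits hx
  exact (IsLocalization.AtPrime.isUnit_to_map_iff (Localization.AtPrime m) m x).1
    (h ⟨m, hm.isPrime⟩) hxm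

/-- A matrix that is, locally on the spectrum, monomial with permutation `σ`. -/
theorem exists_eq_monomialMatrix {a : Matrix ι ι R}
    (σ : LocallyConstant (PrimeSpectrum R) (Equiv.Perm ι))
    (h1 : ∀ p i, IsUnit (algebraMap R (Localization.AtPrime p.asIdeal) (a (σ p i) i)))
    (h0 : ∀ p k i, σ p i ≠ k → algebraMap R (Localization.AtPrime p.asIdeal) (a k i) = 0) :
    ∃ t : ι → Rˣ, a = monomialMatrix t σ := by
  -- The units are the row sums: these are defined over `R` without reference to `σ`, and locally
  -- they equal the only nonzero entry of the row.
  have hsum : ∀ p i, algebraMap R (Localization.AtPrime p.asIdeal) (∑ j, a (σ p i) j) =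
      algebraMap R (Localization.AtPrime p.asIdeal) (a (σ p i) i) := fun p i => by
    rw [map_sum]
    exact Finset.sum_eq_single i
      (fun j _ hj => h0 p _ j fun h => hj ((σ p).injective h)) (by simp)
  have hu : ∀ k, IsUnit (∑ j, a k j) := fun k => isUnit_of_forall_localization fun p => by
    obtain ⟨i, rfl⟩ := (σ p).surjective k
    rw [hsum]
    exact h1 p i
  refine ⟨fun k => (hu k).unit, ?_⟩
  ext k i
  refine eq_of_forall_localization fun p => ?_
  rw [monomialMatrix_local]
  split_ifs with h
  · subst h
    exact (hsum p i).symm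
  · exact h0 p k i h

/-- Invertible matrices `a` and `c` with `a k i * c k j = 0` for `i ≠ j` are locally monomial, with
the same permutation. -/
theorem exists_monomialMatrix_of_mul_eq_zero {a c : Matrix ι ι R} (ha : IsUnit a)
    (hc : IsUnit c) (h : ∀ k i j, i ≠ j → a k i * c k j = 0) :
    ∃ (t s : ι → Rˣ) (σ : LocallyConstant (PrimeSpectrum R) (Equiv.Perm ι)),
      a = monomialMatrix t σ ∧ c = monomialMatrix s σ := by
  have hloc : ∀ p : PrimeSpectrum R, ∃ g : Equiv.Perm ι,
      (∀ i, IsUnit (algebraMap R (Localization.AtPrime p.asIdeal) (a (g i) i)) ∧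
        IsUnit (algebraMap R (Localization.AtPrime p.asIdeal) (c (g i) i))) ∧
      ∀ k i, g i ≠ k → algebraMap R (Localization.AtPrime p.asIdeal) (a k i) = 0 ∧
        algebraMap R (Localization.AtPrime p.asIdeal) (c k i) = 0 := fun p =>
    exists_perm_of_mul_eq_zero
      (ha.map (algebraMap R (Localization.AtPrime p.asIdeal)).mapMatrix)
      (hc.map (algebraMap R (Localization.AtPrime p.asIdeal)).mapMatrix)
      fun k i j hij => by simp [← map_mul, h k i j hij]
  choose f hf1 hf0 using hloc
  have hσ : IsLocallyConstant f := by
    refine IsLocallyConstant.iff_isOpen_fiber.2 fun g => ?_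
    -- The entries at `(g i, i)` are all units at `p` exactly when `g` is the permutation at `p`,
    -- since the other entries vanish there.
    have : f ⁻¹' {g} = ⋂ i, (PrimeSpectrum.basicOpen (a (g i) i) : Set (PrimeSpectrum R)) := by
      ext p
      simp only [Set.mem_preimage, Set.mem_singleton_iff, Set.mem_iInter, SetLike.mem_coe,
        PrimeSpectrum.mem_basicOpen]
      have hiff := fun i => IsLocalization.AtPrime.isUnit_to_map_iff
        (Localization.AtPrime p.asIdeal) p.asIdeal (a (g i) i)
      constructor
      · rintro rfl i
        exact (hiff i).1 (hf1 p i).1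
      · intro hg
        ext i
        by_contra hne
        exact ((hiff i).2 (hg i)).ne_zero (hf0 p _ i hne).1
    rw [this]
    exact isOpen_iInter_of_finite fun i => (PrimeSpectrum.basicOpen _).2
  obtain ⟨t, ht⟩ := exists_eq_monomialMatrix (a := a) ⟨f, hσ⟩ (fun p i => (hf1 p i).1)
    fun p k i hk => (hf0 p k i hk).1
  obtain ⟨s, hs⟩ := exists_eq_monomialMatrix (a := c) ⟨f, hσ⟩ (fun p i => (hf1 p i).2)
    fun p k i hk => (hf0 p k i hk).2
  exact ⟨t, s, _, ht, hs⟩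

/-- The semidirect product of a torus and the symmetric group as locally monomial matrices. -/
def monomialMatrixHom : ((ι → Rˣ) ⋊[permAction (Equiv.Perm ι) R ι]
    LocallyConstant (PrimeSpectrum R) (Equiv.Perm ι)) →* Matrix ι ι R where
  toFun x := monomialMatrix x.left x.right
  map_one' := monomialMatrix_one
  map_mul' x y := monomialMatrix_mul x.left y.left x.right y.right

variable {B : Type*} [AddCommGroup B] [Module R B]

/-- The action of locally monomial matrices on a module with a basis. -/
def monomialHom (b : Module.Basis ι R B) : ((ι → Rˣ) ⋊[permAction (Equiv.Perm ι) R ι]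
    LocallyConstant (PrimeSpectrum R) (Equiv.Perm ι)) →* (B ≃ₗ[R] B) :=
  (LinearMap.GeneralLinearGroup.generalLinearEquiv R B).toMonoidHom.comp
    -- A monoid homomorphism out of a group takes values in units, so each monomial matrix acts
    -- invertibly.
    (MonoidHom.toHomUnits
      ((Matrix.toLinAlgEquiv b : Matrix ι ι R →* Module.End R B).comp monomialMatrixHom))

theorem monomialHom_basis (b : Module.Basis ι R B) (x : (ι → Rˣ) ⋊[permAction (Equiv.Perm ι) R ι]
    LocallyConstant (PrimeSpectrum R) (Equiv.Perm ι)) (i : ι) :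
    monomialHom b x (b i) = ∑ k, monomialMatrix x.left x.right k i • b k :=
  Matrix.toLinAlgEquiv_self b _ i

end Monomial

/-! ### Ternary automorphisms of an evolution algebra -/

section Coordinates

variable (ι : Type*) [Fintype ι] [DecidableEq ι] (R : Type*) [CommRing R]

/-- Selecting the first torus. -/
def semidirectFst : (((ι ⊕ ι) → Rˣ) ⋊[permAction (Equiv.Perm ι) R (ι ⊕ ι)]
    LocallyConstant (PrimeSpectrum R) (Equiv.Perm ι)) →*
    ((ι → Rˣ) ⋊[permAction (Equiv.Perm ι) R ι]
      LocallyConstant (PrimeSpectrum R) (Equiv.Perm ι)) :=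
  SemidirectProduct.map
    { toFun := fun t i => t (Sum.inl i), map_one' := rfl, map_mul' := fun _ _ => rfl }
    (MonoidHom.id _) fun _ => rfl

/-- Selecting the second torus. -/
def semidirectSnd : (((ι ⊕ ι) → Rˣ) ⋊[permAction (Equiv.Perm ι) R (ι ⊕ ι)]
    LocallyConstant (PrimeSpectrum R) (Equiv.Perm ι)) →*
    ((ι → Rˣ) ⋊[permAction (Equiv.Perm ι) R ι]
      LocallyConstant (PrimeSpectrum R) (Equiv.Perm ι)) :=
  SemidirectProduct.map
    { toFun := fun t i => t (Sum.inr i), map_one' := rfl, map_mul' := fun _ _ => rfl }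
    (MonoidHom.id _) fun _ => rfl

/-- Multiplying the two tori. -/
def semidirectMul : (((ι ⊕ ι) → Rˣ) ⋊[permAction (Equiv.Perm ι) R (ι ⊕ ι)]
    LocallyConstant (PrimeSpectrum R) (Equiv.Perm ι)) →*
    ((ι → Rˣ) ⋊[permAction (Equiv.Perm ι) R ι]
      LocallyConstant (PrimeSpectrum R) (Equiv.Perm ι)) :=
  SemidirectProduct.map
    { toFun := fun t => (fun i => t (Sum.inl i)) * fun i => t (Sum.inr i)
      map_one' := mul_one _
      map_mul' := fun _ _ => mul_mul_mul_comm _ _ _ _ }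
    (MonoidHom.id _) fun σ => MonoidHom.ext fun t =>
      (permTorus_mul_right σ (fun i => t (Sum.inl i)) fun i => t (Sum.inr i)).symm

end Coordinates

section Ternary

variable {ι : Type*} [Fintype ι] [DecidableEq ι] {R : Type*} [CommRing R]
  {B : Type*} [NonUnitalNonAssocRing B] [Module R B] [IsScalarTower R B B] [SMulCommClass R B B]
  {b u : Module.Basis ι R B}

theorem sum_smul_mul_sum_smul (hb : ∀ i j, b i * b j = if i = j then u i else 0) (x y : ι → R) :
    (∑ k, x k • b k) * (∑ k, y k • b k) = ∑ k, (x k * y k) • u k := by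
  simp only [Finset.sum_mul, Finset.mul_sum, smul_mul_assoc, mul_smul_comm, hb, smul_ite,
    smul_zero, Finset.sum_ite_eq', Finset.mem_univ, if_true, smul_smul, mul_comm]

theorem ternary_of_basis {κ : Type*} {b : Module.Basis κ R B} {f₁ f₂ f₃ : B ≃ₗ[R] B}
    (h : ∀ i j, f₁ (b i * b j) = f₂ (b i) * f₃ (b j)) (x y : B) : f₁ (x * y) = f₂ x * f₃ y :=
  LinearMap.congr_fun₂ (LinearMap.ext_basis b b h :
    (LinearMap.mul R B).compr₂ f₁.toLinearMap =
      (LinearMap.mul R B).compl₁₂ f₂.toLinearMap f₃.toLinearMap) x y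

/-- Pairs of locally monomial matrices with the same permutation act by ternary automorphisms. -/
def ternaryHom (hb : ∀ i j, b i * b j = if i = j then u i else 0) :
    (((ι ⊕ ι) → Rˣ) ⋊[permAction (Equiv.Perm ι) R (ι ⊕ ι)]
      LocallyConstant (PrimeSpectrum R) (Equiv.Perm ι)) →* ternaryAut R B :=
  (((monomialHom u).comp (semidirectMul ι R)).prod
    (((monomialHom b).comp (semidirectFst ι R)).prod
      ((monomialHom b).comp (semidirectSnd ι R)))).codRestrict _ fun x =>
    ternary_of_basis (b := b) fun i j => by
      change monomialHom u _ _ = monomialHom b _ _ * monomialHom b _ _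
      rw [monomialHom_basis, monomialHom_basis, sum_smul_mul_sum_smul hb, hb]
      change _ = ∑ k, (monomialMatrix _ x.right k i * monomialMatrix _ x.right k j) • u k
      simp only [monomialMatrix_mul_apply]
      split_ifs with hij
      · rw [monomialHom_basis]
        rfl
      · simp

/-- Injectivity needs only the components `f₂` and `f₃`. For surjectivity, these two are shown to be
locally monomial, and `f₁` then agrees on the squares. -/
theorem ternaryHom_bijective (hb : ∀ i j, b i * b j = if i = j then u i else 0) :
    Function.Bijective (ternaryHom hb) := by
  have hinj : ∀ {x y : (ι → Rˣ) ⋊[permAction (Equiv.Perm ι) R ι]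
      LocallyConstant (PrimeSpectrum R) (Equiv.Perm ι)}, monomialHom b x = monomialHom b y →
      x = y := fun {x y} h => by
    have hm : monomialMatrix x.left x.right = monomialMatrix y.left y.right := by
      ext k i
      have h1 := congrArg (fun z => b.repr z k) (LinearEquiv.congr_fun h (b i))
      simpa only [monomialHom_basis, b.repr_sum_self] using h1
    exact SemidirectProduct.ext (monomialMatrix_injective hm).1 (monomialMatrix_injective hm).2
  constructor
  · intro x y h
    have h1 : semidirectFst ι R x = semidirectFst ι R y := hinj (congrArg (fun f => f.1.2.1) h)
    have h2 : semidirectSnd ι R x = semidirectSnd ι R y := hinj (congrArg (fun f => f.1.2.2) h)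
    refine SemidirectProduct.ext (funext ?_) (congrArg SemidirectProduct.right h1 :)
    rintro (i | i)
    · exact congrFun (congrArg SemidirectProduct.left h1) i
    · exact congrFun (congrArg SemidirectProduct.left h2) i
  · rintro ⟨⟨f₁, f₂, f₃⟩, hf⟩
    have hf : ∀ x y, f₁ (x * y) = f₂ x * f₃ y := hf
    have hmat : ∀ (f : B ≃ₗ[R] B) i,
        f (b i) = ∑ k, LinearMap.toMatrixAlgEquiv b f.toLinearMap k i • b k := fun f i => by
      simp only [LinearMap.toMatrixAlgEquiv_apply]
      exact (b.sum_repr _).symm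
    have hunit : ∀ f : B ≃ₗ[R] B, IsUnit (LinearMap.toMatrixAlgEquiv b f.toLinearMap) := fun f =>
      ((LinearMap.GeneralLinearGroup.generalLinearEquiv R B).symm f).isUnit.map
        (LinearMap.toMatrixAlgEquiv b)
    -- The `u`-coordinates of `f₂ (b i) * f₃ (b j) = f₁ 0` are the products of matrix entries that
    -- must vanish.
    obtain ⟨t, s, σ, ht, hs⟩ := exists_monomialMatrix_of_mul_eq_zero (hunit f₂) (hunit f₃)
      fun k i j hij => by
        have h0 := hf (b i) (b j)
        rw [hb, if_neg hij, map_zero, hmat, hmat, sum_smul_mul_sum_smul hb] at h0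
        simpa only [u.repr_sum_self, map_zero, Finsupp.coe_zero, Pi.zero_apply] using
          (congrArg (fun z => u.repr z k) h0).symm
    refine ⟨⟨Sum.elim t s, σ⟩, ?_⟩
    have h2 : monomialHom b (semidirectFst ι R ⟨Sum.elim t s, σ⟩) = f₂ :=
      b.ext' fun i => by rw [monomialHom_basis, hmat f₂, ht]; rfl
    have h3 : monomialHom b (semidirectSnd ι R ⟨Sum.elim t s, σ⟩) = f₃ :=
      b.ext' fun i => by rw [monomialHom_basis, hmat f₃, hs]; rfl
    refine Subtype.ext (Prod.ext (u.ext' fun i => ?_) (Prod.ext h2 h3))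
    have h1 := (ternaryHom hb ⟨Sum.elim t s, σ⟩).2 (b i) (b i)
    have hi : u i = b i * b i := by rw [hb, if_pos rfl]
    rw [hi, hf, ← h2, ← h3]
    exact h1

end Ternary

/-! ### Naturality -/

section Naturality

variable {K : Type*} [Field K] {A : Type*} [NonUnitalNonAssocRing A] [Module K A]
  {R S : Type*} [CommRing R] [Algebra K R] [CommRing S] [Algebra K S]
  {ι : Type*} [Fintype ι] [DecidableEq ι]

/-- Base change applies `φ` to the matrix entries. The target `y` is specified by its two components
so that the lemma applies to both tori and to their product. -/
theorem extendEquiv_monomialHom (φ : R →ₐ[K] S) (b : Module.Basis ι K A)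
    (x : (ι → Rˣ) ⋊[permAction (Equiv.Perm ι) R ι]
      LocallyConstant (PrimeSpectrum R) (Equiv.Perm ι))
    (y : (ι → Sˣ) ⋊[permAction (Equiv.Perm ι) S ι]
      LocallyConstant (PrimeSpectrum S) (Equiv.Perm ι))
    (h₁ : gmMap ι φ.toRingHom x.left = y.left) (h₂ : constMap _ φ.toRingHom x.right = y.right) :
    extendEquiv φ (monomialHom (b.baseChange R) x) = monomialHom (b.baseChange S) y := by
  have hb : ∀ i, φ.toLinearMap.rTensor A (b.baseChange R i) = b.baseChange S i := fun i => by
    simp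
  refine (b.baseChange S).ext' fun i => ?_
  rw [monomialHom_basis, ← hb, extendEquiv_rTensor, monomialHom_basis, map_sum]
  refine Finset.sum_congr rfl fun k _ => ?_
  rw [rTensor_smul, hb, ← h₁, ← h₂]
  exact congrArg (· • _) (map_monomialMatrix φ.toRingHom _ _ k i)

theorem baseChange_mul_baseChange {κ : Type*} [DecidableEq κ] [IsScalarTower K A A]
    [SMulCommClass K A A] {b u : Module.Basis κ K A}
    (hb : ∀ i j, b i * b j = if i = j then u i else 0) (i j : κ) :
    b.baseChange R i * b.baseChange R j = if i = j then u.baseChange R i else 0 := by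
  rw [Module.Basis.baseChange_apply, Module.Basis.baseChange_apply,
    Algebra.TensorProduct.tmul_mul_tmul, hb]
  split_ifs <;> simp

end Naturality

/-- The squares of a natural basis of a perfect evolution algebra form a basis. -/
theorem exists_basis_mul_eq {K A : Type*} [Field K] [NonUnitalNonAssocRing A] [Module K A]
    [IsScalarTower K A A] [SMulCommClass K A A] {n : ℕ}
    (hA : IsEvolutionAlgebra K A n) (hperf : IsPerfectAlgebra K A) :
    ∃ b u : Module.Basis (Fin n) K A, ∀ i j, b i * b j = if i = j then u i else 0 := by
  obtain ⟨b, hb⟩ := hA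
  -- Expanding a product in the natural basis leaves only squares, so `n` squares span an
  -- `n`-dimensional space.
  have hspan : ⊤ ≤ Submodule.span K (Set.range fun i => b i * b i) := by
    rw [← (hperf : Submodule.span K _ = ⊤), Submodule.span_le]
    rintro _ ⟨⟨x, y⟩, rfl⟩
    change x * y ∈ Submodule.span K _
    rw [← b.sum_repr x, ← b.sum_repr y, Finset.sum_mul]
    refine Submodule.sum_mem _ fun i _ => ?_
    rw [Finset.mul_sum]
    refine Submodule.sum_mem _ fun j _ => ?_
    rw [smul_mul_assoc, mul_smul_comm]
    refine Submodule.smul_mem _ _ (Submodule.smul_mem _ _ ?_)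
    obtain rfl | hij := eq_or_ne i j
    · exact Submodule.subset_span ⟨i, rfl⟩
    · rw [hb i j hij]
      exact Submodule.zero_mem _
  refine ⟨b, basisOfTopLeSpanOfCardEqFinrank _ hspan (Module.finrank_eq_card_basis b).symm,
    fun i j => ?_⟩
  rw [coe_basisOfTopLeSpanOfCardEqFinrank]
  split_ifs with hij
  · rw [hij]
  · exact hb i j hij

/-- The ternary automorphism group scheme of an evolution algebra whose natural basis has
linearly independent squares. -/
def torusSemidirectIsoTaut {K A : Type u} [Field K] [NonUnitalNonAssocRing A] [Module K A]
    [IsScalarTower K A A] [SMulCommClass K A A] {ι : Type} [Fintype ι] [DecidableEq ι]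
    {b u : Module.Basis ι K A} (hb : ∀ i j, b i * b j = if i = j then u i else 0) :
    torusSemidirect K (ι ⊕ ι) (Equiv.Perm ι) ≅ tautFunctor K A :=
  NatIso.ofComponents
    (fun R => (MulEquiv.ofBijective (ternaryHom (baseChange_mul_baseChange (R := R) hb))
      (ternaryHom_bijective _)).toGrpIso) fun {R S} φ => by
    ext x : 2
    refine Subtype.ext (Prod.ext ?_ (Prod.ext ?_ ?_))
    -- On the first component the coordinates are products `t (Sum.inl i) * t (Sum.inr i)`, so
    -- naturality uses that `gmMap` is multiplicative.
    · refine (extendEquiv_monomialHom φ.hom u (semidirectMul ι R x) _ ?_ rfl).symm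
      exact map_mul (gmMap ι φ.hom.toRingHom) _ _
    · exact (extendEquiv_monomialHom φ.hom b (semidirectFst ι R x) _ rfl rfl).symm
    · exact (extendEquiv_monomialHom φ.hom b (semidirectSnd ι R x) _ rfl rfl).symm

/-- The semidirect product, as a scheme, is a direct product. -/
def torusSemidirectForgetIso (K : Type u) [Field K] (ι G : Type) [Fintype G] [Group G]
    [MulAction G ι] : torusSemidirect K ι G ⋙ forget GrpCat.{u} ≅
      prodGroup (torus K ι) (constGroup K G) ⋙ forget GrpCat.{u} :=
  NatIso.ofComponents fun _ => SemidirectProduct.equivProd.toIso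

end EvolutionAlgebra

end

open EvolutionAlgebra
theorem theorem3p6 (K A : Type u) [Field K] [NonUnitalNonAssocRing A] [Module K A]
    [IsScalarTower K A A] [SMulCommClass K A A] (n : ℕ)
    (hA : IsEvolutionAlgebra K A n) (hperf : IsPerfectAlgebra K A) :
    (∃ i : torus K (Fin n ⊕ Fin n) ⟶ tautFunctor K A, IsIdentityComponent i) ∧
    (∃ e : torusSemidirect K (Fin n ⊕ Fin n) (Equiv.Perm (Fin n)) ≅ tautFunctor K A,
      IsIdentityComponent (torusInl K (Fin n ⊕ Fin n) (Equiv.Perm (Fin n)) ≫ e.hom)) ∧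
    Nonempty (tautFunctor K A ⋙ forget GrpCat.{u} ≅
      prodGroup (torus K (Fin n ⊕ Fin n)) (constGroup K (Equiv.Perm (Fin n))) ⋙
        forget GrpCat.{u}) := by
  obtain ⟨b, u, hb⟩ := exists_basis_mul_eq hA hperf
  let e := torusSemidirectIsoTaut hb
  have he := (torusInl_isIdentityComponent K (Fin n ⊕ Fin n) (Equiv.Perm (Fin n))).comp_iso e
  exact ⟨⟨_, he⟩, ⟨e, he⟩, ⟨(Functor.isoWhiskerRight e _).symm ≪≫ torusSemidirectForgetIso K _ _⟩⟩
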